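/- All topological spaces are assumed to be completely regular, and all normed spaces are over one fixed field $\mathbb{K}\in\{\mathbb{R},\mathbb{C}\}$. A subset $A$ of a space $Z$ is bounded in $Z$ if every continuous function $Z\to\mathbb{R}$ is bounded on $A$. A space $Z$ is a $\mu$-space if every closed and bounded subset of $Z$ is compact. It is a $wq$-space if every $z\in Z$ has a sequence $(U_n)_{n\in\mathbb{N}}$ of neighborhoods such that, whenever $z_n\in U_n$ for all $n$, the set $\{z_n:n\in\mathbb{N}\}$ is bounded in $Z$. A sieve on $Z$ is a sequence of open covers $\{U_\alpha:\alpha\in A_n\}_{n\in\mathbb{N}}$ of $Z$ together with maps $\pi_n\colon A_{n+1}\to A_n$ such that $U_\alpha=\bigcup\{U_\beta:\beta\in\pi_n^{-1}(\alpha)\}$ for all $n$ and all $\alpha\in A_n$. A sieve is complete if for every sequence $(\alpha_n)$ with $\alpha_n\in A_n$ and $\pi_n(\alpha_{n+1})=\alpha_n$ for all $n$, every filter base $\mathcal{F}$ on $Z$ such that each $B\in\mathcal{F}$ meets each $U_{\alpha_n}$ has a cluster point in $Z$. The space $Z$ is sieve-complete if it has a complete sieve. For a normed space $G$ let $C_k(Z,G)$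 and $C_p(Z,G)$ denote the linear space of all continuous maps $Z\to G$ with the compact-open topology and with the topology of pointwise convergence, respectively. Theorem 4.3. Let $X$ and $Y$ be $\mu$-spaces with $Y$ also a $wq$-space, let $E$ and $F$ be normed spaces with $F\neq\{0\}$, and let $u\colon C_k(X,E)\to C_p(Y,F)$ be a continuous linear surjection. If $X$ is sieve-complete, then $Y$ is sieve-complete. -/

import Mathlib

open Topology

universe u

/-- A subset `A` of `X` is bounded in `X` if every continuous real-valued function on the
whole space `X` is bounded on `A`. -/
def IsBoundedIn {X : Type u} [TopologicalSpace X] (A : Set X) : Prop :=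
  ∀ f : C(X, ℝ), Bornology.IsBounded (f '' A)

/-- A `μ`-space: every closed and bounded subset is compact. -/
def IsMuSpace (X : Type u) [TopologicalSpace X] : Prop :=
  ∀ A : Set X, IsClosed A → IsBoundedIn A → IsCompact A

/-- A `wq`-space: every point `x` has a sequence `(U n)` of neighborhoods such that every
sequence `(s n)` with `s n ∈ U n` for all `n` is bounded in `X`. -/
def IsWqSpace (X : Type u) [TopologicalSpace X] : Prop :=
  ∀ x : X, ∃ U : ℕ → Set X, (∀ n, U n ∈ 𝓝 x) ∧
    ∀ s : ℕ → X, (∀ n, s n ∈ U n) → IsBoundedIn (Set.range s)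

/-- A sieve on a topological space: a sequence of indexed open covers `{U n α : α ∈ A n}` with
maps `π n : A (n + 1) → A n` such that `U n α` is the union of the `U (n + 1) β` over all `β`
in the fibre of `π n` over `α`. -/
structure TopSieve (X : Type u) [TopologicalSpace X] where
  /-- the index set of the `n`-th cover -/
  A : ℕ → Type u
  /-- the members of the `n`-th cover -/
  U : ∀ n, A n → Set X
  /-- the bonding maps between the index sets -/
  π : ∀ n, A (n + 1) → A n
  isOpen_U : ∀ n α, IsOpen (U n α)
  iUnion_U : ∀ n, ⋃ α, U n α = Set.univ
  U_eq : ∀ n α, U n α = ⋃ β ∈ π n ⁻¹' {α}, U (n + 1) β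

/-- A `π`-chain of a sieve: a sequence `α n ∈ A n` with `π n (α (n + 1)) = α n`. -/
def TopSieve.IsChain {X : Type u} [TopologicalSpace X] (S : TopSieve X)
    (α : ∀ n, S.A n) : Prop :=
  ∀ n, S.π n (α (n + 1)) = α n

/-- A sieve is complete if, for every `π`-chain `(α n)`, every proper filter each of whose
members meets every `U n (α n)` has a cluster point. (A filter base and the filter it generates
have the same cluster points, and one meshes with the sets `U n (α n)` iff the other does.) -/
def TopSieve.IsComplete {X : Type u} [TopologicalSpace X] (S : TopSieve X) : Prop :=
  ∀ α : ∀ n, S.A n, S.IsChain α →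
    ∀ F : Filter X, F.NeBot → (∀ B ∈ F, ∀ n, (B ∩ S.U n (α n)).Nonempty) →
      ∃ x, ClusterPt x F

/-- A space is sieve-complete if it has a complete sieve. -/
def IsSieveComplete (X : Type u) [TopologicalSpace X] : Prop :=
  ∃ S : TopSieve X, S.IsComplete

/-- The topology of pointwise convergence on `C(Y, F)`, whose space is `C_p(Y, F)`. -/
abbrev pointwiseTopology (Y F : Type*) [TopologicalSpace Y] [TopologicalSpace F] :
    TopologicalSpace C(Y, F) :=
  TopologicalSpace.induced (fun (f : C(Y, F)) (y : Y) => f y) Pi.topologicalSpace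

/-!
Every functional `f ↦ u f y` is controlled by the values of `f` on a compact set of `X`, so it has a
compact support `supp y ⊆ X`: it vanishes on every `f` that vanishes on `supp y`, and it is bounded
in terms of the supremum of `‖f‖` over `supp y`. The set-valued map `supp` respects boundedness in
both directions.

* If `A ⊆ Y` is bounded, then so is `⋃ y ∈ A, supp y` (`isBoundedIn_iUnion_support`). Otherwise a
  gliding hump along an unbounded function on `X` produces an `f` for which `‖u f‖` is unbounded on
  `A`.
* If `T ⊆ X` is bounded, then so is `{y | supp y ⊆ T}` (`isBoundedIn_setOf_support_subset`).
  Otherwise surjectivity yields an `f` for which `u f` grows on this set faster than the bounds of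
  the functionals allow, although `f` is bounded on the compact set `closure T`.

The rest concerns only a set-valued map with these two properties (`IsSieveComplete.of_supports`).
In a `μ`-space, a decreasing sequence of sets along which all selections are bounded converges to
the compact intersection of the closures (`IsMuSpace.isCompact_iInter_closure`,
`IsMuSpace.exists_subset_of_iInter_closure_subset`). Applied in `X` to the supports of
the points of the `wq`-neighbourhoods of `y ∈ Y`, this shows that for every level of the sieve of
`X`, all points near `y` have their supports in the union of one finite subfamily. Hence `Y` has a
sieve whose members `V` at level `n` come with finite families `𝒰` of members of the `n`-th cover of
`X` such that `closure (⋃ y ∈ V, supp y) ⊆ ⋃ 𝒰`, the families being compatible with the bonding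
maps. Along a chain, Kőnig's lemma for these finite families and completeness of the sieve of `X`
show that the supports of any selection `y n ∈ V n` have a bounded union; so `y` is bounded, and
the convergence lemma, applied in `Y` this time, gives completeness.
-/

open Set Filter

/-! ### Bounded subsets and `μ`-spaces -/

section Bounded

variable {Z : Type*} [TopologicalSpace Z] {A B : Set Z}

theorem isBoundedIn_iff : IsBoundedIn A ↔ ∀ f : C(Z, ℝ), ∃ M, ∀ x ∈ A, |f x| ≤ M := by
  simp [IsBoundedIn, isBounded_iff_forall_norm_le]

theorem exists_unbounded_of_not_isBoundedIn (h : ¬ IsBoundedIn A) :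
    ∃ g : C(Z, ℝ), ∀ M : ℝ, ∃ x ∈ A, M < g x := by
  rw [isBoundedIn_iff] at h
  push Not at h
  obtain ⟨f, hf⟩ := h
  exact ⟨⟨fun x => |f x|, by fun_prop⟩, hf⟩

theorem IsBoundedIn.mono (hB : IsBoundedIn B) (h : A ⊆ B) : IsBoundedIn A :=
  fun f => (hB f).subset (image_mono h)

theorem IsBoundedIn.closure (hA : IsBoundedIn A) : IsBoundedIn (closure A) :=
  fun f => (hA f).closure.subset (image_closure_subset_closure_image f.continuous)

theorem IsBoundedIn.exists_upper_bound (hA : IsBoundedIn A) (g : C(Z, ℝ)) :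
    ∃ M : ℝ, ∀ x ∈ A, g x ≤ M := by
  obtain ⟨M, hM⟩ := isBoundedIn_iff.1 hA g
  exact ⟨M, fun x hx => (le_abs_self _).trans (hM x hx)⟩

theorem IsCompact.isBoundedIn (hA : IsCompact A) : IsBoundedIn A :=
  fun f => (hA.image f.continuous).isBounded

theorem IsMuSpace.isCompact_closure (hZ : IsMuSpace Z) (hA : IsBoundedIn A) :
    IsCompact (_root_.closure A) :=
  hZ _ isClosed_closure hA.closure

variable {V : ℕ → Set Z}

theorem IsMuSpace.isCompact_iInter_closure (hZ : IsMuSpace Z)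
    (hb : ∀ s : ℕ → Z, (∀ n, s n ∈ V n) → IsBoundedIn (range s)) :
    IsCompact (⋂ n, closure (V n)) := by
  refine hZ _ (isClosed_iInter fun _ => isClosed_closure) ?_
  by_contra h
  obtain ⟨g, hg⟩ := exists_unbounded_of_not_isBoundedIn h
  have : ∀ n : ℕ, ∃ z ∈ V n, (n : ℝ) < g z := by
    intro n
    obtain ⟨x, hx, hgx⟩ := hg n
    obtain ⟨z, hz, hzV⟩ := mem_closure_iff.1 (mem_iInter.1 hx n) {z | (n : ℝ) < g z}
      (isOpen_lt continuous_const g.continuous) hgx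
    exact ⟨z, hzV, hz⟩
  choose s hs hgs using this
  obtain ⟨M, hM⟩ := (hb s hs).exists_upper_bound g
  obtain ⟨n, hn⟩ := exists_nat_gt M
  linarith [hM (s n) (mem_range_self n), hgs n]

theorem IsMuSpace.exists_subset_of_iInter_closure_subset (hZ : IsMuSpace Z) (hV : Antitone V)
    (hb : ∀ s : ℕ → Z, (∀ n, s n ∈ V n) → IsBoundedIn (range s)) {O : Set Z} (hO : IsOpen O)
    (hVO : ⋂ n, closure (V n) ⊆ O) : ∃ n, V n ⊆ O := by
  by_contra! h
  choose s hs hsO using fun n => not_subset.1 (h n)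
  obtain ⟨x, -, hx⟩ := (hZ.isCompact_closure (hb s hs)).exists_mapClusterPt (f := atTop) (u := s)
    (tendsto_principal.2 (Eventually.of_forall fun n => subset_closure (mem_range_self n)))
  have hxO : x ∈ O := by
    refine hVO (mem_iInter.2 fun n => mem_closure_iff_nhds.2 fun U hU => ?_)
    obtain ⟨m, hm, hmn⟩ := ((hx.frequently hU).and_eventually (eventually_ge_atTop n)).exists
    exact ⟨s m, hm, hV hmn (hs m)⟩
  obtain ⟨m, hm⟩ := (hx.frequently (hO.mem_nhds hxO)).exists
  exact hsO m hm

end Bounded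

/-! ### Supports of continuous linear maps on function spaces -/

section Support

variable {𝕜 X E F : Type*} [RCLike 𝕜] [TopologicalSpace X]
  [NormedAddCommGroup E] [NormedSpace 𝕜 E] [NormedAddCommGroup F] [NormedSpace 𝕜 F]

/-- The product of a real-valued function and an `E`-valued one, with the real scalars acting on `E`
through `ℝ ⊆ 𝕜`. -/
def realSMul (𝕜 : Type*) [RCLike 𝕜] [NormedSpace 𝕜 E] (φ : C(X, ℝ)) (f : C(X, E)) : C(X, E) where
  toFun x := (φ x : 𝕜) • f x
  continuous_toFun := (RCLike.continuous_ofReal.comp φ.continuous).smul f.continuous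

@[simp]
theorem realSMul_apply (φ : C(X, ℝ)) (f : C(X, E)) (x : X) :
    realSMul 𝕜 φ f x = (φ x : 𝕜) • f x := rfl

theorem norm_realSMul_apply (φ : C(X, ℝ)) (f : C(X, E)) (x : X) :
    ‖realSMul 𝕜 φ f x‖ = |φ x| * ‖f x‖ := by
  simp [norm_smul]

/-- The linear map `L` is bounded with constant `c` for the seminorm `f ↦ sup_{x ∈ K} ‖f x‖`. -/
def IsBoundedOver (L : C(X, E) →ₗ[𝕜] F) (K : Set X) (c : ℝ) : Prop :=
  ∀ (f : C(X, E)) (M : ℝ), 0 ≤ M → (∀ x ∈ K, ‖f x‖ ≤ M) → ‖L f‖ ≤ c * M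

theorem exists_isBoundedOver_of_continuous (L : C(X, E) →ₗ[𝕜] F) (hL : Continuous L) :
    ∃ K, IsCompact K ∧ ∃ c > 0, IsBoundedOver L K c := by
  have h0 : {f : C(X, E) | ‖L f‖ < 1} ∈ 𝓝 (0 : C(X, E)) := by
    refine (isOpen_lt hL.norm continuous_const).mem_nhds ?_
    simp
  rw [(nhds_basis_uniformity' (Metric.uniformity_basis_dist.compactConvergenceUniformity
    (α := X) (β := E))).mem_iff] at h0
  obtain ⟨⟨K, ε⟩, ⟨hK, hε⟩, hKε⟩ := h0
  refine ⟨K, hK, ε⁻¹, inv_pos.2 hε, fun f M hM hf => le_of_forall_pos_lt_add fun δ hδ => ?_⟩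
  have hpos : 0 < M + ε * δ := by positivity
  have h1 : ‖L (((ε / (M + ε * δ) : ℝ) : 𝕜) • f)‖ < 1 := by
    refine hKε fun x hx => ?_
    have : ‖f x‖ < M + ε * δ := (hf x hx).trans_lt (by linarith [mul_pos hε hδ])
    simp only [ContinuousMap.zero_apply, ContinuousMap.smul_apply, dist_zero_left, norm_smul,
      RCLike.norm_ofReal, abs_of_pos (div_pos hε hpos), mem_ofPred_eq]
    rw [div_mul_eq_mul_div, div_lt_iff₀ hpos]
    gcongr
  rw [map_smul, norm_smul, RCLike.norm_ofReal, abs_of_pos (div_pos hε hpos), div_mul_eq_mul_div,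
    div_lt_one hpos] at h1
  calc ‖L f‖ = ε⁻¹ * (ε * ‖L f‖) := by field_simp
    _ < ε⁻¹ * (M + ε * δ) := by gcongr
    _ = ε⁻¹ * M + δ := by field_simp

/-- The support of a linear map `L` on `C(X, E)`: the points `x` such that every neighbourhood of
`x` carries a function on which `L` does not vanish. -/
def linSupport (L : C(X, E) →ₗ[𝕜] F) : Set X :=
  {x | ∀ U ∈ 𝓝 x, ∃ f : C(X, E), (∀ z ∉ U, f z = 0) ∧ L f ≠ 0}

variable {L : C(X, E) →ₗ[𝕜] F} {K : Set X} {c : ℝ}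

theorem isClosed_linSupport : IsClosed (linSupport L) := by
  rw [← isOpen_compl_iff, isOpen_iff_mem_nhds]
  intro x hx
  simp only [linSupport, mem_compl_iff, mem_ofPred_eq, not_forall] at hx
  obtain ⟨U, hU, h⟩ := hx
  filter_upwards [eventually_mem_nhds_iff.2 hU] with z hz hzS using h (hzS U hz)

theorem IsBoundedOver.map_eq_zero (h : IsBoundedOver L K c) {f : C(X, E)}
    (hf : ∀ x ∈ K, f x = 0) : L f = 0 := by
  simpa using h f 0 le_rfl (by simpa using hf)

theorem IsBoundedOver.isCompact_linSupport [R1Space X] (h : IsBoundedOver L K c)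
    (hK : IsCompact K) : IsCompact (linSupport L) := by
  refine hK.closure.of_isClosed_subset isClosed_linSupport fun x hx => ?_
  by_contra hxK
  obtain ⟨f, hf, hLf⟩ := hx _ (isClosed_closure.isOpen_compl.mem_nhds hxK)
  exact hLf (h.map_eq_zero fun z hz => hf z fun hz' => hz' (subset_closure hz))

/-- A compact set disjoint from the support of `L` is contained in `{x | φ x = 1}` for a function
`φ` such that `L` kills all multiples of `φ`. -/
theorem exists_killed_multiplier [CompletelyRegularSpace X] {Q : Set X} (hQ : IsCompact Q)
    (hQL : Disjoint Q (linSupport L)) :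
    ∃ φ : C(X, ℝ), (∀ x, φ x ∈ Icc 0 1) ∧ (∀ x ∈ Q, φ x = 1) ∧
      ∀ f, L (realSMul 𝕜 φ f) = 0 := by
  refine hQ.induction_on (p := fun S => ∃ φ : C(X, ℝ), (∀ x, φ x ∈ Icc 0 1) ∧
    (∀ x ∈ S, φ x = 1) ∧ ∀ f, L (realSMul 𝕜 φ f) = 0) ?_ ?_ ?_ ?_
  · refine ⟨0, by simp, by simp, fun f => ?_⟩
    have : realSMul 𝕜 (0 : C(X, ℝ)) f = 0 := by ext; simp
    rw [this, map_zero]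
  · rintro S T hST ⟨φ, h01, h1, h⟩
    exact ⟨φ, h01, fun x hx => h1 x (hST hx), h⟩
  · rintro S T ⟨φ, hφ, hφ1, hφL⟩ ⟨ψ, hψ, hψ1, hψL⟩
    refine ⟨φ + ψ - φ * ψ, fun x => ?_, ?_, fun f => ?_⟩
    · simp only [ContinuousMap.sub_apply, ContinuousMap.add_apply, ContinuousMap.mul_apply]
      constructor <;> nlinarith [(hφ x).1, (hφ x).2, (hψ x).1, (hψ x).2]
    · rintro x (hx | hx)
      · simp [hφ1 x hx]
      · simp [hψ1 x hx]
    · have : realSMul 𝕜 (φ + ψ - φ * ψ) f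
          = realSMul 𝕜 φ f + realSMul 𝕜 ψ f - realSMul 𝕜 φ (realSMul 𝕜 ψ f) := by
        ext x
        simp [add_smul, sub_smul, mul_smul]
      rw [this, map_sub, map_add, hφL, hφL, hψL]
      simp
  · intro x hx
    have hxL : x ∉ linSupport L := disjoint_left.1 hQL hx
    simp only [linSupport, mem_ofPred_eq, not_forall, not_exists, not_and, not_not] at hxL
    obtain ⟨U, hU, hUL⟩ := hxL
    obtain ⟨θ, hθ, hθx, hθU⟩ := CompletelyRegularSpace.completely_regular x (interior U)ᶜ
      isOpen_interior.isClosed_compl (by simpa using mem_interior_iff_mem_nhds.2 hU)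
    -- The minimum of `1` and `2 - 2θ` is `1` on the neighbourhood `θ < 1 / 2` of `x`, and `0` off `U`.
    have hθc : Continuous fun x => (θ x : ℝ) := continuous_subtype_val.comp hθ
    refine ⟨{z | (θ z : ℝ) < 1 / 2}, mem_nhdsWithin_of_mem_nhds
      ((isOpen_lt hθc continuous_const).mem_nhds (by simp [hθx])),
      ⟨fun z => min 1 (2 - 2 * (θ z : ℝ)), by fun_prop⟩, fun z => ?_, fun z hz => ?_,
      fun f => hUL _ fun z hz => ?_⟩
    · have := (θ z).2.2
      exact ⟨le_min zero_le_one (by linarith), min_le_left _ _⟩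
    · have hz' : (θ z : ℝ) < 1 / 2 := hz
      exact min_eq_left (by linarith)
    · have : θ z = 1 := hθU fun h => hz (interior_subset h)
      simp [this]

/-- A linear map bounded over a compact set kills the functions vanishing on its support. -/
theorem IsBoundedOver.map_eq_zero_of_linSupport [CompletelyRegularSpace X]
    (h : IsBoundedOver L K c) (hK : IsCompact K) (hc : 0 < c) {f : C(X, E)}
    (hf : ∀ x ∈ linSupport L, f x = 0) : L f = 0 := by
  rw [← norm_le_zero_iff]
  refine le_of_forall_pos_le_add fun ε hε => ?_
  obtain ⟨φ, hφ, hφ1, hφL⟩ := exists_killed_multiplier (L := L) (Q := K ∩ {x | ε / c ≤ ‖f x‖})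
    (hK.inter_right (isClosed_le continuous_const f.continuous.norm)) (by
      refine disjoint_left.2 fun x hx hxL => ?_
      have := hx.2
      simp only [mem_ofPred_eq, hf x hxL, norm_zero] at this
      exact absurd this (not_le.2 (div_pos hε hc)))
  have key : ‖L (f - realSMul 𝕜 φ f)‖ ≤ c * (ε / c) := by
    refine h _ _ (div_pos hε hc).le fun x hx => ?_
    by_cases hfx : ε / c ≤ ‖f x‖
    · simpa [hφ1 x ⟨hx, hfx⟩] using (div_pos hε hc).le
    · have h1 : f x - (φ x : 𝕜) • f x = ((1 - φ x : ℝ) : 𝕜) • f x := by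
        simp [sub_smul]
      simp only [ContinuousMap.sub_apply, realSMul_apply, h1, norm_smul, RCLike.norm_ofReal]
      rw [abs_of_nonneg (by linarith [(hφ x).2])]
      nlinarith [(hφ x).1, norm_nonneg (f x)]
  rwa [map_sub, hφL, sub_zero, mul_div_cancel₀ _ hc.ne', ← zero_add ε] at key

theorem IsBoundedOver.norm_le_of_linSupport [CompletelyRegularSpace X] (h : IsBoundedOver L K c)
    (hK : IsCompact K) (hc : 0 < c) {f : C(X, E)} {M : ℝ} (hM : 0 < M)
    (hf : ∀ x ∈ linSupport L, ‖f x‖ ≤ M) : ‖L f‖ ≤ c * M := by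
  -- `f` is truncated to norm at most `M`, which does not change it on the support.
  let φ : C(X, ℝ) := ⟨fun x => M / max M ‖f x‖, continuous_const.div (by fun_prop)
    fun x => (lt_max_of_lt_left hM).ne'⟩
  have h1 : L (f - realSMul 𝕜 φ f) = 0 := by
    refine h.map_eq_zero_of_linSupport hK hc fun x hx => ?_
    simp [φ, max_eq_left (hf x hx), hM.ne']
  rw [map_sub, sub_eq_zero] at h1
  rw [h1]
  refine h _ M hM.le fun x _ => ?_
  have hpos : 0 < max M ‖f x‖ := lt_max_of_lt_left hM
  rw [norm_realSMul_apply]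
  change |M / max M ‖f x‖| * _ ≤ M
  rw [abs_of_pos (div_pos hM hpos), div_mul_eq_mul_div, div_le_iff₀ hpos]
  gcongr
  exact le_max_right _ _

end Support

/-! ### Supports and bounded sets -/

section Pointwise

variable {𝕜 X Y E F : Type*} [RCLike 𝕜] [TopologicalSpace X] [TopologicalSpace Y]
  [NormedAddCommGroup E] [NormedSpace 𝕜 E] [NormedAddCommGroup F] [NormedSpace 𝕜 F]

/-- The linear map `f ↦ u f y`. -/
def evalAt (u : C(X, E) →ₗ[𝕜] C(Y, F)) (y : Y) : C(X, E) →ₗ[𝕜] F where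
  toFun f := u f y
  map_add' f g := by simp
  map_smul' c f := by simp

@[simp]
theorem evalAt_apply (u : C(X, E) →ₗ[𝕜] C(Y, F)) (y : Y) (f : C(X, E)) :
    evalAt u y f = u f y := rfl

variable {u : C(X, E) →ₗ[𝕜] C(Y, F)} [CompletelyRegularSpace X]

/-- One step of the gliding hump: beyond every level `r` of `g`, a function can be changed so that
its image under `u` becomes large somewhere on `A`. -/
theorem exists_gliding_hump_step
    (hu : ∀ y, ∃ K, IsCompact K ∧ ∃ c > 0, IsBoundedOver (evalAt u y) K c) {A : Set Y} {g : C(X, ℝ)}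
    (hg : ∀ M : ℝ, ∃ x ∈ ⋃ y ∈ A, linSupport (evalAt u y), M < g x) (n : ℕ) (P : C(X, E)) (r : ℝ) :
    ∃ y ∈ A, ∃ (P' : C(X, E)) (r' : ℝ), (∀ x, g x ≤ r → P' x = P x) ∧ n ≤ ‖u P' y‖ ∧
      (∀ x ∈ linSupport (evalAt u y), g x ≤ r') ∧ r + 1 ≤ r' := by
  obtain ⟨x, hx, hgx⟩ := hg r
  simp only [mem_iUnion, exists_prop] at hx
  obtain ⟨y, hyA, hxy⟩ := hx
  obtain ⟨f, hf, hfy⟩ := hxy {z | r < g z} ((isOpen_lt continuous_const g.continuous).mem_nhds hgx)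
  obtain ⟨K, hK, c, -, hKc⟩ := hu y
  obtain ⟨M, hM⟩ := (hKc.isCompact_linSupport hK).isBoundedIn.exists_upper_bound g
  rw [evalAt_apply] at hfy
  have hpos : 0 < ‖u f y‖ := norm_pos_iff.2 hfy
  let t : ℝ := (n + ‖u P y‖) / ‖u f y‖
  refine ⟨y, hyA, P + (t : 𝕜) • f, max (r + 1) M, fun z hz => ?_, ?_,
    fun z hz => (hM z hz).trans (le_max_right _ _), le_max_left _ _⟩
  · simp [hf z (by simpa using hz)]
  · have h1 : ‖(t : 𝕜) • u f y‖ = n + ‖u P y‖ := by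
      rw [norm_smul, RCLike.norm_ofReal, abs_of_nonneg (by positivity), div_mul_cancel₀ _ hpos.ne']
    have h2 : ‖(t : 𝕜) • u f y‖ ≤ ‖u P y + (t : 𝕜) • u f y‖ + ‖u P y‖ := by
      simpa using norm_sub_le (u P y + (t : 𝕜) • u f y) (u P y)
    simp only [map_add, map_smul, ContinuousMap.add_apply, ContinuousMap.smul_apply]
    linarith

theorem isBoundedIn_iUnion_support
    (hu : ∀ y, ∃ K, IsCompact K ∧ ∃ c > 0, IsBoundedOver (evalAt u y) K c) {A : Set Y}
    (hA : IsBoundedIn A) : IsBoundedIn (⋃ y ∈ A, linSupport (evalAt u y)) := by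
  by_contra h
  obtain ⟨g, hg⟩ := exists_unbounded_of_not_isBoundedIn h
  choose y hyA P' r' hP' hnorm hr' hrr' using exists_gliding_hump_step hu hg
  let σ : ℕ → C(X, E) × ℝ := fun n => Nat.rec (0, 0) (fun n p => (P' n p.1 p.2, r' n p.1 p.2)) n
  have hσ : ∀ n, σ (n + 1) = (P' n (σ n).1 (σ n).2, r' n (σ n).1 (σ n).2) := fun _ => rfl
  have hr1 : ∀ n, (σ n).2 + 1 ≤ (σ (n + 1)).2 := fun n => by
    rw [hσ]
    exact hrr' _ _ _
  have hmono : Monotone fun n => (σ n).2 := monotone_nat_of_le_succ fun n => by linarith [hr1 n]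
  have hn : ∀ n : ℕ, (n : ℝ) ≤ (σ n).2 := by
    intro n
    induction n with
    | zero => simp [σ]
    | succ n ih =>
      push_cast
      linarith [hr1 n]
  have hstab : ∀ N m, N ≤ m → ∀ x, g x ≤ (σ N).2 → (σ m).1 x = (σ N).1 x := by
    intro N m hNm x hx
    induction m, hNm using Nat.le_induction with
    | base => rfl
    | succ m hm ih =>
      rw [hσ, ← ih]
      exact hP' _ _ _ _ (hx.trans (hmono hm))
  -- The limit of the sequence `(σ n).1`, which is eventually constant on each set `g ≤ N`.
  let f₀ : X → E := fun x => (σ ⌈g x⌉₊).1 x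
  have hf₀ : ∀ N x, g x ≤ (σ N).2 → f₀ x = (σ N).1 x := by
    intro N x hx
    rw [← hstab N _ (le_max_left N ⌈g x⌉₊) x hx,
      hstab ⌈g x⌉₊ _ (le_max_right N ⌈g x⌉₊) x ((Nat.le_ceil _).trans (hn _))]
  have hcont : Continuous f₀ := by
    rw [continuous_iff_continuousAt]
    intro x
    obtain ⟨N, hN⟩ := exists_nat_gt (g x)
    refine ((σ N).1.continuous.continuousAt (x := x)).congr ?_
    filter_upwards [(isOpen_lt g.continuous continuous_const).mem_nhds hN] with z hz
    exact (hf₀ N z ((le_of_lt hz).trans (hn N))).symm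
  let f : C(X, E) := ⟨f₀, hcont⟩
  obtain ⟨M, hM⟩ := isBoundedIn_iff.1 hA ⟨fun y => ‖u f y‖, (u f).continuous.norm⟩
  obtain ⟨n, hnM⟩ := exists_nat_gt M
  obtain ⟨K, hK, c, hc, hKc⟩ := hu (y n (σ n).1 (σ n).2)
  have heq : evalAt u (y n (σ n).1 (σ n).2) (f - (σ (n + 1)).1) = 0 := by
    refine hKc.map_eq_zero_of_linSupport hK hc fun x hx => ?_
    rw [ContinuousMap.sub_apply, sub_eq_zero]
    exact hf₀ (n + 1) x (hr' n _ _ x hx)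
  rw [map_sub, sub_eq_zero, evalAt_apply, evalAt_apply] at heq
  have h1 := hM _ (hyA n (σ n).1 (σ n).2)
  have h2 := hnorm n (σ n).1 (σ n).2
  simp only [ContinuousMap.coe_mk, abs_norm, heq] at h1
  rw [hσ] at h1
  linarith

/-- Every sequence of reals is dominated by a continuous function on `ℝ`. -/
theorem exists_continuous_dominating (a : ℕ → ℝ) :
    ∃ ψ : C(ℝ, ℝ), ∀ (n : ℕ) (s : ℝ), n ≤ s → a n ≤ ψ s := by
  have := exists_continuous_forall_mem_convex_of_local_const (X := ℝ) (E := ℝ)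
    (t := fun s => ⋂ (n : ℕ) (_ : (n : ℝ) ≤ s), Ici (a n))
    (fun s => convex_iInter fun n => convex_iInter fun _ => convex_Ici _) (fun s => by
      obtain ⟨N, hN⟩ := exists_nat_gt s
      refine ⟨∑ n ∈ Finset.range N, |a n|, ?_⟩
      filter_upwards [eventually_lt_nhds hN] with s' hs'
      simp only [mem_iInter, mem_Ici]
      intro n hn
      refine (le_abs_self _).trans (Finset.single_le_sum (f := fun n => |a n|)
        (fun _ _ => abs_nonneg _) (Finset.mem_range.2 ?_))
      exact_mod_cast hn.trans_lt hs')
  obtain ⟨ψ, hψ⟩ := this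
  exact ⟨ψ, fun n s hns => by simpa using mem_iInter₂.1 (hψ s) n hns⟩

theorem isBoundedIn_setOf_support_subset [Nontrivial F]
    (hu : ∀ y, ∃ K, IsCompact K ∧ ∃ c > 0, IsBoundedOver (evalAt u y) K c)
    (hsurj : Function.Surjective u) {T : Set X} (hT : IsBoundedIn T) :
    IsBoundedIn {y | linSupport (evalAt u y) ⊆ T} := by
  by_contra h
  obtain ⟨g, hg⟩ := exists_unbounded_of_not_isBoundedIn h
  choose y hyT hgy using fun n : ℕ => hg n
  choose K hK c hc hKc using hu
  obtain ⟨e, he⟩ := exists_ne (0 : F)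
  have he' : 0 < ‖e‖ := norm_pos_iff.2 he
  obtain ⟨ψ, hψ⟩ := exists_continuous_dominating fun n => n * c (y n) / ‖e‖
  obtain ⟨f, hf⟩ := hsurj ⟨fun z => (ψ (g z) : 𝕜) • e,
    (RCLike.continuous_ofReal.comp (ψ.continuous.comp g.continuous)).smul continuous_const⟩
  obtain ⟨M, hM⟩ := hT.exists_upper_bound ⟨fun x => ‖f x‖, f.continuous.norm⟩
  obtain ⟨n, hn⟩ := exists_nat_gt (max M 1)
  have h1 : ‖u f (y n)‖ ≤ c (y n) * max M 1 :=
    (hKc (y n)).norm_le_of_linSupport (hK _) (hc _) (by positivity)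
      fun x hx => (hM x (hyT n hx)).trans (le_max_left _ _)
  have h2 : n * c (y n) ≤ ‖u f (y n)‖ := by
    rw [hf]
    simp only [ContinuousMap.coe_mk, norm_smul, RCLike.norm_ofReal]
    rw [← div_le_iff₀ he']
    exact (hψ n _ (hgy n).le).trans (le_abs_self _)
  nlinarith [hc (y n)]

end Pointwise

/-! ### Sieves -/

section Sieve

/-- A sieve is obtained from a strategy that, given a state and a point in its open set, answers
with a smaller open set still containing the point. The members of the `n`-th cover are indexed by
the sequences of `n + 1` points played against the strategy, so that the index types live in the
universe of the space, whatever the universe of the states is. -/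
theorem isSieveComplete_of_states {Y : Type*} [TopologicalSpace Y] {State : ℕ → Type*}
    (V : ∀ n, State n → Set Y) (R : ∀ n, State n → State (n + 1) → Prop)
    (hopen : ∀ n σ, IsOpen (V n σ)) (hinit : ∀ y, ∃ σ, y ∈ V 0 σ)
    (hstep : ∀ n σ y, ∃ σ', R n σ σ' ∧ V (n + 1) σ' ⊆ V n σ ∧ (y ∈ V n σ → y ∈ V (n + 1) σ'))
    (hcomplete : ∀ σ : ∀ n, State n, (∀ n, R n (σ n) (σ (n + 1))) →
      Antitone (fun n => V n (σ n)) → ∀ F : Filter Y, F.NeBot →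
      (∀ B ∈ F, ∀ n, (B ∩ V n (σ n)).Nonempty) → ∃ x, ClusterPt x F) :
    IsSieveComplete Y := by
  choose i hi using hinit
  choose next hR hsub hmem using hstep
  let st : ∀ n, (Fin (n + 1) → Y) → State n := fun n => Nat.rec (fun a => i (a 0))
    (fun n s a => next n (s (Fin.init a)) (a (Fin.last _))) n
  have hst : ∀ n a, st (n + 1) a = next n (st n (Fin.init a)) (a (Fin.last _)) := fun _ _ => rfl
  have hU : ∀ n α, V n (st n α)
      = ⋃ β ∈ (fun β : Fin (n + 2) → Y => (Fin.init β : Fin (n + 1) → Y)) ⁻¹' {α},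
        V (n + 1) (st (n + 1) β) := by
    refine fun n α => subset_antisymm (fun y hy => ?_) (iUnion₂_subset fun β hβ => ?_)
    · refine mem_iUnion₂.2 ⟨Fin.snoc α y, by simp, ?_⟩
      rw [hst]
      simpa using hmem n _ y hy
    · rw [hst, show Fin.init β = α from hβ]
      exact hsub _ _ _
  refine ⟨⟨fun n => Fin (n + 1) → Y, fun n a => V n (st n a), fun n β => Fin.init β,
    fun n _ => hopen n _, fun n => ?_, hU⟩, fun α hα F hF hB => ?_⟩
  · rw [eq_univ_iff_forall]
    intro y
    induction n with
    | zero => exact mem_iUnion.2 ⟨fun _ => y, hi y⟩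
    | succ n ih =>
      obtain ⟨α, hα⟩ := mem_iUnion.1 ih
      rw [hU] at hα
      obtain ⟨β, -, hβ⟩ := mem_iUnion₂.1 hα
      exact mem_iUnion.2 ⟨β, hβ⟩
  · have hα' : ∀ n, st (n + 1) (α (n + 1)) = next n (st n (α n)) (α (n + 1) (Fin.last _)) := by
      intro n
      rw [hst, show Fin.init (α (n + 1)) = α n from hα n]
    refine hcomplete (fun n => st n (α n)) (fun n => ?_) (antitone_nat_of_succ_le fun n => ?_)
      F hF hB
    · rw [hα']
      exact hR _ _ _
    · rw [hα']
      exact hsub _ _ _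

variable {X : Type*} [TopologicalSpace X]

theorem TopSieve.U_subset (S : TopSieve X) (n : ℕ) (β : S.A (n + 1)) :
    S.U (n + 1) β ⊆ S.U n (S.π n β) := by
  rw [S.U_eq n (S.π n β)]
  exact subset_biUnion_of_mem (u := fun β => S.U (n + 1) β) rfl

/-- Kőnig's lemma: a sequence of finite nonempty sets of indices that is respected by the bonding
maps contains a chain. -/
theorem TopSieve.exists_isChain (S : TopSieve X) (T : ∀ n, Set (S.A n)) (hfin : ∀ n, (T n).Finite)
    (hne : ∀ n, (T n).Nonempty) (hT : ∀ n, MapsTo (S.π n) (T (n + 1)) (T n)) :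
    ∃ α : ∀ n, S.A n, S.IsChain α ∧ ∀ n, α n ∈ T n := by
  let G : CategoryTheory.Functor ℕᵒᵖ (Type _) := CategoryTheory.Functor.ofOpSequence (X := fun n => T n)
    fun n => TypeCat.ofHom ((hT n).restrict)
  have : ∀ j, Finite (G.obj j) := fun j => (hfin j.unop).to_subtype
  have : ∀ j, Nonempty (G.obj j) := fun j => (hne j.unop).to_subtype
  obtain ⟨s, hs⟩ := nonempty_sections_of_finite_inverse_system G
  refine ⟨fun n => (s (.op n) : T n).1, fun n => ?_, fun n => (s (.op n) : T n).2⟩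
  have h := hs (CategoryTheory.homOfLE (Nat.le_add_right n 1)).op
  rw [CategoryTheory.Functor.ofOpSequence_map_homOfLE_succ] at h
  exact congrArg (fun z : T n => z.1) h

/-- In a space with a complete sieve, a sequence whose `n`-th term lies in a finite union of members
of the `n`-th cover has a cluster point, provided the finite families are respected by the bonding maps. -/
theorem TopSieve.IsComplete.exists_mapClusterPt {S : TopSieve X} (hS : S.IsComplete)
    {T : ∀ n, Set (S.A n)} (hfin : ∀ n, (T n).Finite)
    (hT : ∀ n, MapsTo (S.π n) (T (n + 1)) (T n)) {x : ℕ → X}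
    (hx : ∀ n, x n ∈ ⋃ α ∈ T n, S.U n α) : ∃ z, MapClusterPt z atTop x := by
  let G : Ultrafilter X := (Ultrafilter.of atTop).map x
  have hGle : (G : Filter X) ≤ map x atTop := map_mono (Ultrafilter.of_le _)
  have hW : Antitone fun n => ⋃ α ∈ T n, S.U n α := by
    refine antitone_nat_of_succ_le fun n => iUnion₂_subset fun β hβ => ?_
    exact (S.U_subset n β).trans (subset_biUnion_of_mem (u := fun α => S.U n α) (hT n hβ))
  have hWG : ∀ n, (⋃ α ∈ T n, S.U n α) ∈ G := by
    refine fun n => hGle ?_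
    rw [mem_map]
    filter_upwards [eventually_ge_atTop n] with m hm using hW hm (hx m)
  obtain ⟨α, hα, hαT⟩ := S.exists_isChain (fun n => {α ∈ T n | S.U n α ∈ G})
    (fun n => (hfin n).subset (sep_subset _ _))
    (fun n => by simpa [Set.Nonempty] using (Ultrafilter.finite_biUnion_mem_iff (hfin n)).1 (hWG n))
    (fun n β hβ => ⟨hT n hβ.1, mem_of_superset hβ.2 (S.U_subset n β)⟩)
  obtain ⟨z, hz⟩ := hS α hα G inferInstance
    fun B hB n => G.nonempty_of_mem (inter_mem hB (hαT n).2)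
  exact ⟨z, hz.mono hGle⟩

end Sieve

/-! ### Transferring sieve-completeness along a set-valued map -/

section Transfer

variable {X Y : Type*} [TopologicalSpace X] [TopologicalSpace Y] {supp : Y → Set X}

/-- In a `wq`-space, the supports of the points near `y` converge to a compact set. -/
theorem exists_isCompact_limit_of_supports (hX : IsMuSpace X) (hYq : IsWqSpace Y)
    (hbdd : ∀ A, IsBoundedIn A → IsBoundedIn (⋃ y ∈ A, supp y)) {V : Set Y} (hV : IsOpen V)
    {y : Y} (hy : y ∈ V) :
    ∃ C ⊆ closure (⋃ y ∈ V, supp y), IsCompact C ∧ ∀ O, IsOpen O → C ⊆ O →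
      ∃ N ⊆ V, IsOpen N ∧ y ∈ N ∧ ⋃ z ∈ N, supp z ⊆ O := by
  obtain ⟨U, hU, hUb⟩ := hYq y
  let N : ℕ → Set Y := fun n => interior (⋂ m ∈ Iic n, U m) ∩ V
  have hN : Antitone N := fun m n hmn =>
    inter_subset_inter_left _ (interior_mono (biInter_subset_biInter_left (Iic_subset_Iic.2 hmn)))
  have hNU : ∀ n, N n ⊆ U n := fun n =>
    inter_subset_left.trans (interior_subset.trans (biInter_subset_of_mem self_mem_Iic))
  have hyN : ∀ n, y ∈ N n := fun n =>
    ⟨mem_interior_iff_mem_nhds.2 ((biInter_mem (finite_Iic n)).2 fun m _ => hU m), hy⟩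
  have hmono : ∀ {A B : Set Y}, A ⊆ B → ⋃ z ∈ A, supp z ⊆ ⋃ z ∈ B, supp z :=
    fun h => biUnion_subset_biUnion_left h
  have hseq : ∀ s : ℕ → X, (∀ n, s n ∈ ⋃ z ∈ N n, supp z) → IsBoundedIn (range s) := by
    intro s hs
    simp only [mem_iUnion, exists_prop] at hs
    choose z hzN hsz using hs
    refine (hbdd _ (hUb z fun n => hNU n (hzN n))).mono ?_
    rintro _ ⟨n, rfl⟩
    exact mem_biUnion (mem_range_self n) (hsz n)
  refine ⟨⋂ n, closure (⋃ z ∈ N n, supp z), (iInter_subset _ 0).trans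
    (closure_mono (hmono inter_subset_right)), hX.isCompact_iInter_closure hseq,
    fun O hO hCO => ?_⟩
  obtain ⟨n, hn⟩ := hX.exists_subset_of_iInter_closure_subset (fun m n h => hmono (hN h)) hseq
    hO hCO
  exact ⟨N n, inter_subset_right, isOpen_interior.inter hV, hyN n, hn⟩

/-- An open cover of the closure of the supports of the points of `V` can be replaced near each
point of `V` by a finite subfamily. -/
theorem exists_finite_refinement [RegularSpace X] (hX : IsMuSpace X) (hYq : IsWqSpace Y)
    (hbdd : ∀ A, IsBoundedIn A → IsBoundedIn (⋃ y ∈ A, supp y)) {V : Set Y} (hV : IsOpen V)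
    {y : Y} (hy : y ∈ V) {ι : Type*} {U : ι → Set X} (hU : ∀ β, IsOpen (U β))
    (hVU : closure (⋃ y ∈ V, supp y) ⊆ ⋃ β, U β) :
    ∃ N ⊆ V, IsOpen N ∧ y ∈ N ∧ ∃ T : Set ι, T.Finite ∧
      closure (⋃ z ∈ N, supp z) ⊆ ⋃ β ∈ T, U β := by
  obtain ⟨C, hCV, hC, hlim⟩ := exists_isCompact_limit_of_supports hX hYq hbdd hV hy
  obtain ⟨T, hT⟩ := hC.elim_finite_subcover U hU (hCV.trans hVU)
  obtain ⟨O, hO, hCO, hOT⟩ := hC.exists_isOpen_closure_subset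
    ((isOpen_biUnion fun β (_ : β ∈ T) => hU β).mem_nhdsSet.2 hT)
  obtain ⟨N, hNV, hN, hyN, hNO⟩ := hlim O hO hCO
  exact ⟨N, hNV, hN, hyN, T, T.finite_toSet, (closure_mono hNO).trans hOT⟩

/-- Sieve-completeness passes from `X` to `Y` along a compact-valued map `supp` from `Y` to the
subsets of `X` that respects boundedness in both directions; no continuity of `supp` is needed. -/
theorem IsSieveComplete.of_supports [RegularSpace X] (hX : IsMuSpace X) (hY : IsMuSpace Y)
    (hYq : IsWqSpace Y) (hcpt : ∀ y, IsCompact (supp y))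
    (hbdd : ∀ A, IsBoundedIn A → IsBoundedIn (⋃ y ∈ A, supp y))
    (hbdd' : ∀ T, IsBoundedIn T → IsBoundedIn {y | supp y ⊆ T}) (hXs : IsSieveComplete X) :
    IsSieveComplete Y := by
  obtain ⟨S, hS⟩ := hXs
  let State : ℕ → Type _ := fun n => {p : Set Y × Set (S.A n) // IsOpen p.1 ∧ p.2.Finite ∧
    closure (⋃ y ∈ p.1, supp y) ⊆ ⋃ α ∈ p.2, S.U n α}
  refine isSieveComplete_of_states (State := State) (fun n σ => σ.1.1)
    (fun n σ σ' => MapsTo (S.π n) σ'.1.2 σ.1.2) (fun n σ => σ.2.1) (fun y => ?_)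
    (fun n σ y => ?_) (fun σ hσ hanti F hF hB => ?_)
  · obtain ⟨N, -, hN, hyN, T, hT, hNT⟩ := exists_finite_refinement hX hYq hbdd isOpen_univ
      (mem_univ y) (S.isOpen_U 0) (by rw [S.iUnion_U]; exact subset_univ _)
    exact ⟨⟨(N, T), hN, hT, hNT⟩, hyN⟩
  · by_cases hy : y ∈ σ.1.1
    · obtain ⟨N, hNV, hN, hyN, T, hT, hNT⟩ := exists_finite_refinement hX hYq hbdd σ.2.1 hy
        (U := fun β : {β // S.π n β ∈ σ.1.2} => S.U (n + 1) β) (fun β => S.isOpen_U _ _) (by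
          refine σ.2.2.2.trans (iUnion₂_subset fun α hα => ?_)
          rw [S.U_eq]
          exact iUnion₂_subset fun β hβ => subset_iUnion
            (fun β : {β // S.π n β ∈ σ.1.2} => S.U (n + 1) β) ⟨β, by
              rw [show S.π n β = α from hβ]; exact hα⟩)
      refine ⟨⟨(N, (↑) '' T), hN, hT.image _, by rwa [biUnion_image]⟩, ?_, hNV,
        fun _ => hyN⟩
      rintro _ ⟨β, -, rfl⟩
      exact β.2
    · exact ⟨⟨(∅, ∅), isOpen_empty, finite_empty, by simp⟩, mapsTo_empty _ _, empty_subset _,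
        fun h => absurd h hy⟩
  have hseq : ∀ s : ℕ → Y, (∀ n, s n ∈ (σ n).1.1) → IsBoundedIn (range s) := by
    intro s hs
    suffices h : IsBoundedIn (⋃ n, supp (s n)) from
      (hbdd' _ h).mono (range_subset_iff.2 fun n => subset_iUnion (fun n => supp (s n)) n)
    by_contra h
    obtain ⟨g, hg⟩ := exists_unbounded_of_not_isBoundedIn h
    -- The supports are compact, so `g` is already unbounded on the union of those from `k` on.
    have : ∀ k : ℕ, ∃ m ≥ k, ∃ x ∈ supp (s m), (k : ℝ) < g x := by
      intro k
      obtain ⟨M, hM⟩ := ((finite_Iio k).isCompact_biUnion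
        fun m _ => hcpt (s m)).isBoundedIn.exists_upper_bound g
      obtain ⟨x, hx, hgx⟩ := hg (max M k)
      obtain ⟨m, hm⟩ := mem_iUnion.1 hx
      refine ⟨m, ?_, x, hm, (le_max_right _ _).trans_lt hgx⟩
      by_contra! hmk
      exact ((le_max_left _ _).trans_lt hgx).not_ge (hM x (mem_biUnion hmk hm))
    choose m hm x hx hgx using this
    obtain ⟨z, hz⟩ := hS.exists_mapClusterPt (fun n => (σ n).2.2.1) hσ (x := x) fun k =>
      (σ k).2.2.2 (subset_closure (mem_biUnion (hanti (hm k) (hs (m k))) (hx k)))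
    obtain ⟨n, hn⟩ := exists_nat_gt (g z)
    obtain ⟨k, hk, hnk⟩ := ((hz.frequently ((isOpen_lt g.continuous continuous_const).mem_nhds
      hn)).and_eventually (eventually_ge_atTop n)).exists
    have hk' : g (x k) < n := hk
    have : (n : ℝ) ≤ k := by exact_mod_cast hnk
    linarith [hgx k]
  by_contra! hcl
  obtain ⟨O, hO, hCO, hOF⟩ : ∃ O, IsOpen O ∧ ⋂ n, closure (σ n).1.1 ⊆ O ∧ Oᶜ ∈ F := by
    have h : Disjoint (𝓝ˢ (⋂ n, closure (σ n).1.1)) F :=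
      (hY.isCompact_iInter_closure hseq).disjoint_nhdsSet_left.2 fun z _ =>
        disjoint_iff.2 (not_neBot.1 (hcl z))
    obtain ⟨O, ⟨hO, hCO⟩, hOF⟩ := (hasBasis_nhdsSet _).disjoint_iff_left.1 h
    exact ⟨O, hO, hCO, hOF⟩
  obtain ⟨n, hn⟩ := hY.exists_subset_of_iInter_closure_subset hanti hseq hO hCO
  obtain ⟨y, hyO, hyn⟩ := hB _ hOF n
  exact hyO (hn hyn)

end Transfer

theorem theorem4p3 {𝕜 : Type*} [RCLike 𝕜]
    {X Y E F : Type*}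
    [TopologicalSpace X] [CompletelyRegularSpace X]
    [TopologicalSpace Y] [CompletelyRegularSpace Y]
    [NormedAddCommGroup E] [NormedSpace 𝕜 E]
    [NormedAddCommGroup F] [NormedSpace 𝕜 F] [Nontrivial F]
    (hX : IsMuSpace X) (hY : IsMuSpace Y) (hYq : IsWqSpace Y)
    (u : C(X, E) →ₗ[𝕜] C(Y, F))
    (hu : Continuous[ContinuousMap.compactOpen, pointwiseTopology Y F] u)
    (hsurj : Function.Surjective u)
    (hXs : IsSieveComplete X) :
    IsSieveComplete Y := by
  have hbound : ∀ y, ∃ K, IsCompact K ∧ ∃ c > 0, IsBoundedOver (evalAt u y) K c := fun y =>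
    exists_isBoundedOver_of_continuous _ (continuous_pi_iff.1 (continuous_induced_rng.1 hu) y)
  refine IsSieveComplete.of_supports (supp := fun y => linSupport (evalAt u y)) hX hY hYq
    (fun y => ?_) (fun A hA => isBoundedIn_iUnion_support hbound hA)
    (fun T hT => isBoundedIn_setOf_support_subset hbound hsurj hT) hXs
  obtain ⟨K, hK, c, -, hKc⟩ := hbound y
  exact hKc.isCompact_linSupport hK
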